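/- Let $q$ be a power of an odd prime, let $n\ge 2$, and let $A$ be an invertible symmetric $n\times n$ matrix over $\mathbb F_q$. The quadric of $A$ is the set of one-dimensional subspaces $\langle x\rangle$ of $\mathbb F_q^n$ with $x^\top A x=0$. Assume that the quadric is either parabolic (that is, $n$ is odd) or hyperbolic (that is, $n$ is even and the quadric has $\frac{(q^{n/2}-1)(q^{n/2-1}+1)}{q-1}$ points), and that the Witt index of $A$, i.e. the largest dimension of a subspace $W$ that is totally isotropic ($x^\top A y=0$ for all $x,y\in W$), is at least $2$. Let $\Gamma=VO_n^{\varepsilon}(q)$ be the affine polar graph of $A$: its vertex set is $V=\mathbb F_q^n$, and distinct $x,y$ are adjacent if and only if $(x-y)^\top A(x-y)=0$. A graph is a core if all its endomorphisms are automorphisms; a core of a graph $G$ is a subgraph $G'$ of $G$ that is a core and admits a homomorphism $G\to G'$ (it exists and is unique up to isomorphism if $G$ is finite). Let $\omega$, $\alpha$, $\chi$ denote the clique number, the independence number and the chromatic number. Then the following statements are equivalent: (i) $\omega(\Gamma)\,\alpha(\Gamma)=|V|$; (ii) the core of $\Gamma$ is a complete graph; (iii) the core of the complement $\overline{\Gamma}$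 is a complete graph; (iv) $\Gamma$ is not a core; (v) $\chi(\Gamma)=\omega(\Gamma)$. If any of (i)–(v) is true, then the polar space of $A$ has an ovoid, that is, there is a subset $\mathcal O$ of the quadric such that every maximal totally isotropic subspace of $\mathbb F_q^n$ contains exactly one element of $\mathcal O$. -/

import Mathlib

open scoped Matrix LinearAlgebra.Projectivization

namespace SimpleGraph

/-- A graph is a core if every endomorphism of it is an automorphism. -/
def IsCore {V : Type*} (G : SimpleGraph V) : Prop :=
  ∀ f : G →g G, ∃ e : G ≃g G, ∀ v, e v = f v

/-- A subgraph `H` of `G` is a core of `G` if `H` is a core and there is a homomorphism from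
`G` to `H`. -/
def IsCoreOf {V : Type*} (G : SimpleGraph V) (H : G.Subgraph) : Prop :=
  H.coe.IsCore ∧ Nonempty (G →g H.coe)

/-- The core of `G` (which is unique up to isomorphism) is a complete graph: `G` has a core, and
every core of `G` is complete. -/
def CoreIsComplete {V : Type*} (G : SimpleGraph V) : Prop :=
  (∃ H : G.Subgraph, G.IsCoreOf H) ∧ ∀ H : G.Subgraph, G.IsCoreOf H → H.coe = ⊤

end SimpleGraph

namespace PolarSpace

variable {F : Type*} [Field F] {n : ℕ}

/-- The quadric of `A`: the projective points `⟨x⟩` with `xᵀ A x = 0`. -/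
def quadric (A : Matrix (Fin n) (Fin n) F) : Set (ℙ F (Fin n → F)) :=
  {p | ∀ x ∈ p.submodule, x ⬝ᵥ A *ᵥ x = 0}

/-- The quadric of `A` is parabolic: the dimension `n` is odd. -/
def IsParabolic (_A : Matrix (Fin n) (Fin n) F) : Prop :=
  Odd n

/-- The quadric of `A` is hyperbolic: `n` is even and, for `q = |F|`, the quadric has
`(q ^ (n / 2) - 1) (q ^ (n / 2 - 1) + 1) / (q - 1)` points. -/
def IsHyperbolic (A : Matrix (Fin n) (Fin n) F) : Prop :=
  Even n ∧ Nat.card (quadric A) * (Nat.card F - 1) =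
    (Nat.card F ^ (n / 2) - 1) * (Nat.card F ^ (n / 2 - 1) + 1)

/-- A subspace `W` is totally isotropic if `xᵀ A y = 0` for all `x, y ∈ W`. -/
def IsTotallyIsotropic (A : Matrix (Fin n) (Fin n) F) (W : Submodule F (Fin n → F)) : Prop :=
  ∀ x ∈ W, ∀ y ∈ W, x ⬝ᵥ A *ᵥ y = 0

/-- The Witt index: the largest dimension of a totally isotropic subspace. -/
noncomputable def wittIndex (A : Matrix (Fin n) (Fin n) F) : ℕ :=
  sSup {d | ∃ W : Submodule F (Fin n → F), IsTotallyIsotropic A W ∧ Module.finrank F W = d}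

/-- A generator: a maximal totally isotropic subspace. -/
def IsGenerator (A : Matrix (Fin n) (Fin n) F) (W : Submodule F (Fin n → F)) : Prop :=
  Maximal (IsTotallyIsotropic A) W

/-- An ovoid: a set of points of the quadric that meets every generator in exactly one point. -/
def IsOvoid (A : Matrix (Fin n) (Fin n) F) (O : Set (ℙ F (Fin n → F))) : Prop :=
  O ⊆ quadric A ∧ ∀ W, IsGenerator A W → ∃! p, p ∈ O ∧ p.submodule ≤ W

/-- The affine polar graph of `A`: distinct vectors `x, y` are adjacent if and only if
`(x - y)ᵀ A (x - y) = 0`. -/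
def affinePolarGraph (A : Matrix (Fin n) (Fin n) F) : SimpleGraph (Fin n → F) where
  Adj x y := x ≠ y ∧ (x - y) ⬝ᵥ A *ᵥ (x - y) = 0
  symm := ⟨fun x y h => ⟨h.1.symm, by
    rw [← neg_sub x y, Matrix.mulVec_neg, neg_dotProduct_neg]; exact h.2⟩⟩
  loopless := ⟨fun _ h => h.1 rfl⟩

end PolarSpace

/-!
The equivalence of all statements but the fourth is a fact about finite translation-invariant
graphs `G` on an abelian group `V`. If `K` is a clique and `S` an independent set, then the
differences `k - s` are pairwise distinct (`SimpleGraph.IsClique.sub_injective`), so `ω α ≤ |V|`.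
In case of equality every vertex is uniquely `k - s`; the component `k` is a proper colouring with
`ω` colours, and conversely the colour classes of such a colouring show that `|V| ≤ ω α`
(`SimpleGraph.colorable_cliqueNum_iff_mul_eq`). The condition `ω α = |V|` is symmetric under
complementation, and the core of a finite graph is complete if and only if the graph is
`ω`-colourable (`SimpleGraph.coreIsComplete_iff_colorable`).

The remaining implication is that an affine polar graph which is not a core has a complete core.
A proper endomorphism `f` identifies two vertices `x`, `y`, whose difference has a norm `c ≠ 0`.
Moving `x` along an isotropic direction not orthogonal to `x - y` gives neighbours of `x` whose
difference from `y` has any prescribed norm `d ≠ c`; they are mapped to neighbours of `f x = f y`. As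
the isometries are transitive on the vectors of norm `d ≠ 0`, every pair of vertices can be
identified or made adjacent by an endomorphism, which is impossible for two non-adjacent vertices
of the core (`PolarSpace.coreIsComplete_of_not_isCore`).

For the ovoid, all generators have the same dimension and are maximum cliques
(`PolarSpace.IsGenerator.isNClique`). If `ω α = |V|`, a maximum independent set `S` therefore
meets every translate of every generator exactly once, and for `v ∉ S` the lines joining `v` to its
neighbours in `S` form an ovoid (`PolarSpace.exists_isOvoid`).
-/

/-! ### Cores of finite graphs -/

namespace SimpleGraph

section Core

variable {V : Type*} {G : SimpleGraph V}

/-- The map induced on the finite set of ordered pairs of adjacent vertices is injective, hence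
surjective. -/
lemma Hom.adj_iff_of_injective [Finite V] (f : G →g G) (hf : Function.Injective f) {a b : V} :
    G.Adj (f a) (f b) ↔ G.Adj a b := by
  refine ⟨fun hab => ?_, fun hab => f.map_adj hab⟩
  let φ : {p : V × V // G.Adj p.1 p.2} → {p : V × V // G.Adj p.1 p.2} :=
    fun p => ⟨(f p.1.1, f p.1.2), f.map_adj p.2⟩
  have hφ : Function.Injective φ := by
    rintro ⟨⟨a, b⟩, h⟩ ⟨⟨c, d⟩, h'⟩ e
    simp only [φ, Subtype.mk.injEq, Prod.mk.injEq] at e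
    simp [hf e.1, hf e.2]
  obtain ⟨⟨⟨c, d⟩, hcd⟩, e⟩ := Finite.injective_iff_surjective.mp hφ ⟨(f a, f b), hab⟩
  simp only [φ, Subtype.mk.injEq, Prod.mk.injEq] at e
  rw [← hf e.1, ← hf e.2]
  exact hcd

lemma isCore_iff_forall_injective [Finite V] :
    G.IsCore ↔ ∀ f : G →g G, Function.Injective f := by
  refine ⟨fun h f => ?_, fun h f => ?_⟩
  · obtain ⟨e, he⟩ := h f
    have : (f : V → V) = e := funext fun v => (he v).symm
    rw [this]
    exact e.injective
  · exact ⟨⟨Equiv.ofBijective f (Finite.injective_iff_bijective.mp (h f)),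
      f.adj_iff_of_injective (h f)⟩, fun v => rfl⟩

/-- The image of an endomorphism with the fewest vertices is a core. -/
lemma exists_isCoreOf [Finite V] (G : SimpleGraph V) : ∃ H : G.Subgraph, G.IsCoreOf H := by
  obtain ⟨f, hf⟩ : ∃ f : G →g G, ∀ g : G →g G, (Set.range f).ncard ≤ (Set.range g).ncard := by
    have : Nonempty (G →g G) := ⟨Hom.id⟩
    exact ⟨Function.argmin (fun f : G →g G => (Set.range f).ncard),
      fun g => Function.argmin_le (fun f : G →g G => (Set.range f).ncard) g⟩
  let H : G.Subgraph := (⊤ : G.Subgraph).induce (Set.range f)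
  let f' : G →g H.coe := ⟨fun v => ⟨f v, v, rfl⟩, fun {a b} hab => by
    simpa [H] using f.map_adj hab⟩
  refine ⟨H, isCore_iff_forall_injective.mpr fun g => ?_, ⟨f'⟩⟩
  have hsub : Set.range (H.hom.comp (g.comp f')) ⊆ Set.range f := by
    rintro _ ⟨v, rfl⟩
    exact (g (f' v)).2
  have heq := Set.eq_of_subset_of_ncard_le hsub (hf _)
  refine Finite.injective_iff_surjective.mpr ?_
  rintro ⟨w, hw⟩
  obtain ⟨v, hv⟩ : w ∈ Set.range (H.hom.comp (g.comp f')) := heq ▸ hw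
  exact ⟨f' v, Subtype.ext hv⟩

/-- If any two vertices can be identified or made adjacent by an endomorphism, then no two vertices
of a core are non-adjacent: an endomorphism of a finite core is injective and reflects adjacency. -/
lemma coreIsComplete_of_forall_exists_hom [Finite V]
    (h : ∀ a b, a ≠ b → ∃ f : G →g G, f a = f b ∨ G.Adj (f a) (f b)) : G.CoreIsComplete := by
  refine ⟨G.exists_isCoreOf, fun H hH => ?_⟩
  obtain ⟨hcore, ⟨r⟩⟩ := hH
  ext a b
  rw [top_adj]
  refine ⟨fun hab => hab.ne, fun hab => ?_⟩
  obtain ⟨f, hf⟩ := h a b (fun e => hab (Subtype.ext e))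
  let g : H.coe →g H.coe := r.comp (f.comp H.hom)
  have hg := isCore_iff_forall_injective.mp hcore g
  rcases hf with hf | hf
  · exact absurd (hg (congrArg r hf)) hab
  · exact (g.adj_iff_of_injective hg).mp (r.map_adj hf)

lemma cliqueNum_le_of_colorable {m : ℕ} (h : G.Colorable m) : G.cliqueNum ≤ m := by
  obtain ⟨s, hs⟩ := G.exists_isNClique_cliqueNum
  rw [← hs.card_eq]
  exact hs.isClique.card_le_of_colorable h

lemma chromaticNumber_eq_cliqueNum_iff :
    G.chromaticNumber = (G.cliqueNum : ℕ∞) ↔ G.Colorable G.cliqueNum := by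
  refine ⟨fun h => chromaticNumber_le_iff_colorable.mp h.le, fun h => ?_⟩
  refine le_antisymm h.chromaticNumber_le (le_chromaticNumber_iff_colorable.mpr fun m hm => ?_)
  exact_mod_cast cliqueNum_le_of_colorable hm

/-- A colouring with `G.cliqueNum` colours is a homomorphism to a maximum clique. -/
lemma Colorable.exists_hom_isClique_range (h : G.Colorable G.cliqueNum) :
    ∃ f : G →g G, G.IsClique (Set.range f) := by
  obtain ⟨c⟩ := h
  obtain ⟨s, hs⟩ := G.exists_isNClique_cliqueNum
  let e : Fin G.cliqueNum ≃ s := (finCongr hs.card_eq.symm).trans s.equivFin.symm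
  have hadj : ∀ i j, i ≠ j → G.Adj (e i) (e j) := fun i j hij =>
    hs.isClique (e i).2 (e j).2 fun h => hij (e.injective (Subtype.ext h))
  refine ⟨⟨fun v => e (c v), fun {a b} hab => hadj _ _ (c.valid hab)⟩, ?_⟩
  rintro _ ⟨a, rfl⟩ _ ⟨b, rfl⟩ hab
  exact hadj _ _ fun h => hab (congrArg (fun i => (e i : V)) h)

lemma coreIsComplete_iff_colorable [Finite V] :
    G.CoreIsComplete ↔ G.Colorable G.cliqueNum := by
  constructor
  · rintro ⟨⟨H, hH⟩, htop⟩
    have hHtop := htop H hH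
    obtain ⟨-, ⟨r⟩⟩ := hH
    have hfin := Fintype.ofFinite H.verts
    have hcl : G.IsClique H.verts := fun a ha b hb hab => by
      have : H.coe.Adj ⟨a, ha⟩ ⟨b, hb⟩ := by
        rw [hHtop, top_adj]
        exact fun e => hab (congrArg Subtype.val e)
      exact H.adj_sub this
    have hcard : Fintype.card H.verts ≤ G.cliqueNum := by
      rw [← Set.toFinset_card]
      exact IsClique.card_le_cliqueNum (tc := by simpa using hcl)
    rw [hHtop] at r
    exact (Coloring.colorable (r : G.Coloring H.verts)).mono hcard
  · intro h
    obtain ⟨f, hf⟩ := h.exists_hom_isClique_range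
    exact coreIsComplete_of_forall_exists_hom fun a b _ =>
      ⟨f, or_iff_not_imp_left.mpr fun hab => hf ⟨a, rfl⟩ ⟨b, rfl⟩ hab⟩

lemma Colorable.not_isCore [Finite V] (h : G.Colorable G.cliqueNum) (hG : G ≠ ⊤) :
    ¬ G.IsCore := by
  intro hcore
  obtain ⟨f, hf⟩ := h.exists_hom_isClique_range
  have hinj := isCore_iff_forall_injective.mp hcore f
  refine hG ?_
  ext a b
  rw [top_adj]
  exact ⟨fun hab => hab.ne, fun hab =>
    (f.adj_iff_of_injective hinj).mp (hf ⟨a, rfl⟩ ⟨b, rfl⟩ (hinj.ne hab))⟩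

lemma Colorable.card_le_mul_indepNum [Finite V] {m : ℕ} (h : G.Colorable m) :
    Nat.card V ≤ m * G.indepNum := by
  classical
  have := Fintype.ofFinite V
  obtain ⟨c⟩ := h
  rw [Nat.card_eq_fintype_card, ← Finset.card_univ, mul_comm]
  simpa using Finset.card_le_mul_card_image_of_maps_to (s := Finset.univ) (t := Finset.univ)
    (f := c) (fun _ _ => Finset.mem_univ _) G.indepNum fun i _ => by
      refine IsIndepSet.card_le_indepNum ?_
      intro a ha b hb _ hab
      simp only [Finset.coe_filter, Finset.mem_univ, true_and, Set.mem_ofPred_eq] at ha hb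
      exact c.valid hab (ha.trans hb.symm)

end Core

/-! ### Cliques and independent sets in translation-invariant graphs -/

section Translation

variable {V : Type*} [AddCommGroup V] {G : SimpleGraph V}

/-- In a translation-invariant graph, a clique and an independent set have no non-zero difference
in common. -/
lemma IsClique.sub_injective (hG : ∀ x y t, G.Adj x y → G.Adj (x + t) (y + t)) {K S : Finset V}
    (hK : G.IsClique K) (hS : G.IsIndepSet S) :
    Function.Injective fun p : K × S => (p.1 - p.2 : V) := by
  rintro ⟨⟨k, hk⟩, ⟨s, hs⟩⟩ ⟨⟨k', hk'⟩, ⟨s', hs'⟩⟩ h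
  simp only at h
  by_cases hkk : k = k'
  · subst hkk
    simpa using h
  · have hadj := hG _ _ (s - k) (hK hk hk' hkk)
    have h1 : k + (s - k) = s := by abel
    have h2 : k' + (s - k) = s' := by
      rw [eq_comm, ← sub_eq_zero, ← sub_eq_zero.mpr h]
      abel
    rw [h1, h2] at hadj
    exact absurd hadj (hS hs hs' hadj.ne)

lemma cliqueNum_mul_indepNum_le [Finite V] (hG : ∀ x y t, G.Adj x y → G.Adj (x + t) (y + t)) :
    G.cliqueNum * G.indepNum ≤ Nat.card V := by
  obtain ⟨K, hK⟩ := G.exists_isNClique_cliqueNum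
  obtain ⟨S, hS⟩ := G.exists_isNIndepSet_indepNum
  have := Nat.card_le_card_of_injective _ (hK.isClique.sub_injective hG hS.isIndepSet)
  simpa [Nat.card_prod, hK.card_eq, hS.card_eq] using this

lemma IsNClique.sub_bijective [Finite V] (hG : ∀ x y t, G.Adj x y → G.Adj (x + t) (y + t))
    (h : G.cliqueNum * G.indepNum = Nat.card V) {K S : Finset V}
    (hK : G.IsNClique G.cliqueNum K) (hS : G.IsNIndepSet G.indepNum S) :
    Function.Bijective fun p : K × S => (p.1 - p.2 : V) := by
  refine (Nat.bijective_iff_injective_and_card _).mpr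
    ⟨hK.isClique.sub_injective hG hS.isIndepSet, ?_⟩
  simp [hK.card_eq, hS.card_eq, h]

/-- If `V = K - S` uniquely, for a clique `K` and an independent set `S`, then the component in `K`
is a colouring. -/
lemma colorable_cliqueNum_of_mul_eq [Finite V] (hG : ∀ x y t, G.Adj x y → G.Adj (x + t) (y + t))
    (h : G.cliqueNum * G.indepNum = Nat.card V) : G.Colorable G.cliqueNum := by
  obtain ⟨K, hK⟩ := G.exists_isNClique_cliqueNum
  obtain ⟨S, hS⟩ := G.exists_isNIndepSet_indepNum
  choose φ hφ using (hK.sub_bijective hG h hS).surjective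
  let c : G.Coloring K := Coloring.mk (fun v => (φ v).1) fun {a b} hab e => by
    have hadj := hG _ _ ((φ a).2 + (φ b).2 - (φ a).1) hab
    have h1 : a + ((φ a).2 + (φ b).2 - (φ a).1 : V) = (φ b).2 := by
      nth_rewrite 1 [← hφ a]
      simp only
      abel
    have h2 : b + ((φ a).2 + (φ b).2 - (φ a).1 : V) = (φ a).2 := by
      nth_rewrite 1 [← hφ b]
      simp only [e]
      abel
    rw [h1, h2] at hadj
    exact hS.isIndepSet (φ b).2.2 (φ a).2.2 hadj.ne hadj
  have := c.colorable
  rwa [Fintype.card_coe, hK.card_eq] at this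

lemma colorable_cliqueNum_iff_mul_eq [Finite V]
    (hG : ∀ x y t, G.Adj x y → G.Adj (x + t) (y + t)) :
    G.Colorable G.cliqueNum ↔ G.cliqueNum * G.indepNum = Nat.card V :=
  ⟨fun h => le_antisymm (cliqueNum_mul_indepNum_le hG) h.card_le_mul_indepNum,
    colorable_cliqueNum_of_mul_eq hG⟩

lemma compl_adj_add (hG : ∀ x y t, G.Adj x y → G.Adj (x + t) (y + t)) (x y t : V)
    (h : Gᶜ.Adj x y) : Gᶜ.Adj (x + t) (y + t) := by
  rw [compl_adj] at h ⊢
  refine ⟨fun e => h.1 (add_right_cancel e), fun e => h.2 ?_⟩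
  simpa using hG _ _ (-t) e

end Translation

end SimpleGraph

/-! ### Isotropic vectors and isometries of symmetric bilinear forms -/

namespace LinearMap.BilinForm

variable {F V : Type*} [Field F] [AddCommGroup V] [Module F V] {B : LinearMap.BilinForm F V}

/-- The isometry is the reflection in `u - v` or, up to sign, the one in `u + v`: the norms of
`u - v` and `u + v` add up to `4 * B u u`, so one of them is non-zero. -/
lemma exists_isometry_apply_eq (h2 : (2 : F) ≠ 0) (hB : ∀ x y, B x y = B y x) {u v : V}
    (huv : B u u = B v v) (hu : B u u ≠ 0) :
    ∃ g : V →ₗ[F] V, (∀ x y, B (g x) (g y) = B x y) ∧ g u = v := by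
  let ρ : V → V →ₗ[F] V := fun a => LinearMap.id - (B a).smulRight ((2 / B a a) • a)
  have hρ : ∀ a x, ρ a x = x - (2 / B a a * B a x) • a := fun a x => by
    simp [ρ, smul_smul, mul_comm]
  have hiso : ∀ a, B a a ≠ 0 → ∀ x y, B (ρ a x) (ρ a y) = B x y := fun a ha x y => by
    simp only [hρ, map_sub, map_smul, LinearMap.sub_apply, LinearMap.smul_apply, smul_eq_mul,
      hB x a]
    field_simp
    ring
  by_cases hs : B (u - v) (u - v) = 0
  · have hsum : B (u + v) (u + v) = 4 * B u u := by
      simp only [map_add, map_sub, LinearMap.add_apply, LinearMap.sub_apply, hB v u,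
        ← huv] at hs ⊢
      linear_combination -hs
    have hne : B (u + v) (u + v) ≠ 0 := by
      rw [hsum, show (4 : F) = 2 * 2 by norm_num]
      exact mul_ne_zero (mul_ne_zero h2 h2) hu
    refine ⟨-ρ (u + v), fun x y => by simpa using hiso _ hne x y, ?_⟩
    have hc : 2 / B (u + v) (u + v) * B (u + v) u = 1 := by
      rw [div_mul_eq_mul_div, div_eq_one_iff_eq hne]
      simp only [map_add, LinearMap.add_apply, hB v u, ← huv]
      ring
    rw [LinearMap.neg_apply, hρ, hc, one_smul]
    abel
  · refine ⟨ρ (u - v), hiso _ hs, ?_⟩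
    have hc : 2 / B (u - v) (u - v) * B (u - v) u = 1 := by
      rw [div_mul_eq_mul_div, div_eq_one_iff_eq hs]
      simp only [map_sub, LinearMap.sub_apply, hB v u, ← huv]
      ring
    rw [hρ, hc, one_smul]
    abel

/-- A hyperbolic line through an isotropic vector contains a second isotropic vector, and the line
can be chosen not to be orthogonal to `u`. -/
lemma exists_isotropic_apply_ne_zero (h2 : (2 : F) ≠ 0) (hB : ∀ x y, B x y = B y x)
    (hnd : ∀ x ≠ 0, ∃ y, B x y ≠ 0) {w u : V} (hw : w ≠ 0) (hww : B w w = 0)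
    (hu : B u u ≠ 0) : ∃ z, B z z = 0 ∧ B u z ≠ 0 := by
  by_cases huw : B u w = 0
  · obtain ⟨v, hwv, huv⟩ : ∃ v, B w v ≠ 0 ∧ B u v ≠ 0 := by
      obtain ⟨v, hv⟩ := hnd w hw
      by_cases huv : B u v = 0
      · exact ⟨v + u, by simpa [hB w u, huw] using hv, by simpa [huv] using hu⟩
      · exact ⟨v, hv, huv⟩
    refine ⟨v - (B v v / (2 * B w v)) • w, ?_, by simpa [huw] using huv⟩
    simp only [map_sub, map_smul, LinearMap.sub_apply, LinearMap.smul_apply, smul_eq_mul, hww,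
      hB v w]
    field_simp
    ring
  · exact ⟨w, hww, huw⟩

lemma exists_apply_self_ne_zero (h2 : (2 : F) ≠ 0) (hB : ∀ x y, B x y = B y x)
    (hnd : ∀ x ≠ 0, ∃ y, B x y ≠ 0) {w : V} (hw : w ≠ 0) : ∃ u, B u u ≠ 0 := by
  obtain ⟨v, hv⟩ := hnd w hw
  by_contra! h
  have := h (w + v)
  simp only [map_add, LinearMap.add_apply, h w, h v, hB v w, zero_add, add_zero] at this
  rw [← two_mul] at this
  exact mul_ne_zero h2 hv this

/-- If `dim W < dim U`, then some vector of `U` outside `W` is orthogonal to `W`: the functionals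
`B u` on `W`, for `u ∈ U`, all vanish on `U ⊓ W`, so they span a space of dimension at most
`dim W - dim (U ⊓ W)`. -/
lemma exists_mem_notMem_orthogonal [FiniteDimensional F V] {U W : Submodule F V}
    (hU : ∀ x ∈ U, ∀ y ∈ U, B x y = 0) (h : Module.finrank F W < Module.finrank F U) :
    ∃ u ∈ U, u ∉ W ∧ ∀ w ∈ W, B u w = 0 := by
  by_contra! hcon
  let φ : U →ₗ[F] Module.Dual F W := (W.subtype.dualMap ∘ₗ B) ∘ₗ U.subtype
  have hφ : ∀ u w, φ u w = B u w := fun u w => rfl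
  have hker : (LinearMap.ker φ).map U.subtype ≤ W ⊓ U := by
    rintro _ ⟨u, hu, rfl⟩
    refine ⟨?_, u.2⟩
    by_contra huW
    obtain ⟨w, hw, hne⟩ := hcon u u.2 huW
    exact hne (LinearMap.congr_fun (LinearMap.mem_ker.mp hu) ⟨w, hw⟩)
  have hrange : LinearMap.range φ ≤ (U.comap W.subtype).dualAnnihilator := by
    rintro _ ⟨u, rfl⟩
    rw [Submodule.mem_dualAnnihilator]
    exact fun w hw => hU u u.2 w hw
  have h1 := φ.finrank_range_add_finrank_ker
  have h2 := Submodule.finrank_mono hrange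
  have h3 := Submodule.finrank_mono hker
  have h4 := Subspace.finrank_add_finrank_dualAnnihilator_eq (U.comap W.subtype)
  rw [Submodule.finrank_map_subtype_eq] at h3
  have h5 : Module.finrank F (U.comap W.subtype) = Module.finrank F (W ⊓ U : Submodule F V) := by
    rw [← Submodule.map_comap_subtype, Submodule.finrank_map_subtype_eq]
  omega

end LinearMap.BilinForm

/-! ### Affine polar graphs -/

namespace PolarSpace

variable {F : Type*} [Field F] {n : ℕ} {A : Matrix (Fin n) (Fin n) F}

lemma affinePolarGraph_adj {x y : Fin n → F} : (affinePolarGraph A).Adj x y ↔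
    x ≠ y ∧ Matrix.toBilin' A (x - y) (x - y) = 0 := by
  rw [Matrix.toBilin'_apply']
  rfl

lemma affinePolarGraph_adj_add (x y t : Fin n → F) (h : (affinePolarGraph A).Adj x y) :
    (affinePolarGraph A).Adj (x + t) (y + t) := by
  rw [affinePolarGraph_adj] at h ⊢
  rw [add_sub_add_right_eq_sub]
  exact ⟨fun e => h.1 (add_right_cancel e), h.2⟩

lemma toBilin'_comm (hA : A.IsSymm) (x y : Fin n → F) :
    Matrix.toBilin' A x y = Matrix.toBilin' A y x := by
  rw [Matrix.toBilin'_apply', Matrix.toBilin'_apply', Matrix.dotProduct_mulVec,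
    ← Matrix.mulVec_transpose, hA.eq, dotProduct_comm]

lemma exists_toBilin'_ne_zero (hA : A.IsSymm) (hdet : A.det ≠ 0) (x : Fin n → F) (hx : x ≠ 0) :
    ∃ y, Matrix.toBilin' A x y ≠ 0 := by
  by_contra! h
  refine hdet (Matrix.exists_mulVec_eq_zero_iff.mp ⟨x, hx, ?_⟩)
  refine dotProduct_eq_zero _ fun y => ?_
  rw [← h y, toBilin'_comm hA, Matrix.toBilin'_apply', dotProduct_comm]

lemma exists_isotropic_of_wittIndex_pos (h : 0 < wittIndex A) :
    ∃ w : Fin n → F, w ≠ 0 ∧ Matrix.toBilin' A w w = 0 := by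
  obtain ⟨W, hW, hd⟩ : wittIndex A ∈ {d | ∃ W : Submodule F (Fin n → F),
      IsTotallyIsotropic A W ∧ Module.finrank F W = d} := by
    refine Nat.sSup_mem ⟨0, ⊥, ?_, finrank_bot F _⟩ ⟨n, ?_⟩
    · intro x hx y _
      rw [(Submodule.mem_bot F).mp hx, zero_dotProduct]
    · rintro d ⟨W, -, rfl⟩
      simpa using W.finrank_le
  have hne : W ≠ ⊥ := by
    rintro rfl
    rw [finrank_bot] at hd
    omega
  obtain ⟨w, hw, hw0⟩ := W.exists_mem_ne_zero_of_ne_bot hne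
  exact ⟨w, hw0, by rw [Matrix.toBilin'_apply']; exact hW w hw w hw⟩

/-- A translation composed with a linear isometry moves any pair of vertices to any other pair with
the same non-zero norm of the difference. -/
lemma exists_hom_apply_eq (h2 : (2 : F) ≠ 0) (hA : A.IsSymm) (hdet : A.det ≠ 0)
    {a b x y : Fin n → F}
    (h : Matrix.toBilin' A (a - b) (a - b) = Matrix.toBilin' A (x - y) (x - y))
    (h0 : Matrix.toBilin' A (a - b) (a - b) ≠ 0) :
    ∃ f : affinePolarGraph A →g affinePolarGraph A, f a = x ∧ f b = y := by
  obtain ⟨g, hg, hgu⟩ :=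
    LinearMap.BilinForm.exists_isometry_apply_eq h2 (toBilin'_comm hA) h h0
  refine ⟨⟨fun v => g (v - b) + y, fun {v w} hvw => ?_⟩, ?_, ?_⟩
  · refine affinePolarGraph_adj_add _ _ _ ?_
    rw [affinePolarGraph_adj] at hvw ⊢
    rw [← map_sub, sub_sub_sub_cancel_right, hg]
    refine ⟨fun e => ?_, hvw.2⟩
    obtain ⟨z, hz⟩ := exists_toBilin'_ne_zero hA hdet _ (sub_ne_zero.mpr hvw.1)
    rw [← hg, ← sub_sub_sub_cancel_right v w b, map_sub, e, sub_self, map_zero] at hz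
    exact hz rfl
  · change g (a - b) + y = x
    rw [hgu, sub_add_cancel]
  · simp

/-- Let the endomorphism `f` identify `x` and `y`. For an isotropic `z` not orthogonal to `x - y`,
the vertices `x + s • z` with `s ≠ 0` are neighbours of `x`, so `f` maps them to neighbours of
`f x = f y`, while the norm of `x + s • z - y` takes every value as `s` varies. Hence `f` identifies two vertices or makes them adjacent for
each possible norm of their difference, and all pairs of the same norm are equivalent. -/
lemma coreIsComplete_of_not_isCore [Finite F] (h2 : (2 : F) ≠ 0) (hA : A.IsSymm)
    (hdet : A.det ≠ 0) (hw : ∃ w : Fin n → F, w ≠ 0 ∧ Matrix.toBilin' A w w = 0)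
    (h : ¬ (affinePolarGraph A).IsCore) : (affinePolarGraph A).CoreIsComplete := by
  obtain ⟨w, hw0, hww⟩ := hw
  rw [SimpleGraph.isCore_iff_forall_injective] at h
  push Not at h
  obtain ⟨f, hf⟩ := h
  obtain ⟨x, y, hfxy, hxy⟩ : ∃ x y, f x = f y ∧ x ≠ y := by
    simpa [Function.Injective] using hf
  have hc : Matrix.toBilin' A (x - y) (x - y) ≠ 0 := fun h0 =>
    (f.map_adj (affinePolarGraph_adj.mpr ⟨hxy, h0⟩)).ne hfxy
  obtain ⟨z, hzz, hz⟩ := LinearMap.BilinForm.exists_isotropic_apply_ne_zero h2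
    (toBilin'_comm hA) (exists_toBilin'_ne_zero hA hdet) hw0 hww hc
  refine SimpleGraph.coreIsComplete_of_forall_exists_hom fun a b hab => ?_
  by_cases hd : Matrix.toBilin' A (a - b) (a - b) = 0
  · exact ⟨SimpleGraph.Hom.id, Or.inr (affinePolarGraph_adj.mpr ⟨hab, hd⟩)⟩
  -- `s` solves the equation that `x + s • z - y` and `a - b` have the same norm, linear in `s`.
  obtain ⟨s, hs⟩ : ∃ s : F, s = (Matrix.toBilin' A (a - b) (a - b) -
      Matrix.toBilin' A (x - y) (x - y)) / (2 * Matrix.toBilin' A (x - y) z) := ⟨_, rfl⟩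
  have hnorm : Matrix.toBilin' A (a - b) (a - b) =
      Matrix.toBilin' A (x + s • z - y) (x + s • z - y) := by
    rw [add_sub_right_comm, LinearMap.map_add₂, map_add, map_add, LinearMap.map_smul₂,
      LinearMap.map_smul₂, map_smul, map_smul, hzz, toBilin'_comm hA z, hs]
    simp only [smul_eq_mul]
    field_simp
    ring
  obtain ⟨g, hga, hgb⟩ := exists_hom_apply_eq h2 hA hdet hnorm hd
  refine ⟨f.comp g, ?_⟩
  change f (g a) = f (g b) ∨ (affinePolarGraph A).Adj (f (g a)) (f (g b))
  rw [hga, hgb, ← hfxy]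
  by_cases hsz : s • z = 0
  · left
    rw [hsz, add_zero]
  · right
    refine f.map_adj (affinePolarGraph_adj.mpr ⟨by simpa using hsz, ?_⟩)
    simp [hzz]

lemma affinePolarGraph_ne_top (h2 : (2 : F) ≠ 0) (hA : A.IsSymm) (hdet : A.det ≠ 0)
    (hw : ∃ w : Fin n → F, w ≠ 0) : affinePolarGraph A ≠ ⊤ := by
  obtain ⟨w, hw0⟩ := hw
  obtain ⟨u, hu⟩ := LinearMap.BilinForm.exists_apply_self_ne_zero h2
    (toBilin'_comm hA) (exists_toBilin'_ne_zero hA hdet) hw0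
  intro e
  have hu0 : u ≠ 0 := by
    rintro rfl
    simp at hu
  have : (affinePolarGraph A).Adj u 0 := by rw [e]; exact hu0
  rw [affinePolarGraph_adj, sub_zero] at this
  exact hu this.2

/-! ### Generators and ovoids -/

lemma IsTotallyIsotropic.isClique {W : Submodule F (Fin n → F)} (hW : IsTotallyIsotropic A W) :
    (affinePolarGraph A).IsClique (W : Set (Fin n → F)) := fun _ hx _ hy hxy =>
  ⟨hxy, hW _ (W.sub_mem hx hy) _ (W.sub_mem hx hy)⟩

/-- In odd characteristic, a clique through `0` spans a totally isotropic subspace: the norms of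
`x`, `y` and `x - y` determine `B x y`. -/
lemma isTotallyIsotropic_span (h2 : (2 : F) ≠ 0) (hA : A.IsSymm) {K : Set (Fin n → F)}
    (hK : (affinePolarGraph A).IsClique K) (h0 : 0 ∈ K) :
    IsTotallyIsotropic A (Submodule.span F K) := by
  have hq : ∀ x ∈ K, ∀ y ∈ K, Matrix.toBilin' A (x - y) (x - y) = 0 := fun x hx y hy => by
    by_cases hxy : x = y
    · simp [hxy]
    · exact (affinePolarGraph_adj.mp (hK hx hy hxy)).2
  have hb : ∀ x ∈ K, ∀ y ∈ K, Matrix.toBilin' A x y = 0 := fun x hx y hy => by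
    have h1 := hq x hx 0 h0
    have h3 := hq y hy 0 h0
    have h4 := hq x hx y hy
    rw [sub_zero] at h1 h3
    simp only [map_sub, LinearMap.sub_apply, h1, h3, toBilin'_comm hA y x] at h4
    exact (mul_eq_zero.mp (by linear_combination -h4 :
      2 * Matrix.toBilin' A x y = 0)).resolve_left h2
  intro x hx y hy
  rw [← Matrix.toBilin'_apply']
  induction hx, hy using Submodule.span_induction₂ with
  | mem_mem x y hx hy => exact hb x hx y hy
  | zero_left y hy => simp
  | zero_right x hx => simp
  | add_left x y z _ _ _ h h' => simp [h, h']
  | add_right x y z _ _ _ h h' => simp [h, h']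
  | smul_left r x y _ _ h => simp [h]
  | smul_right r x y _ _ h => simp [h]

lemma IsGenerator.finrank_le (hA : A.IsSymm) {U W : Submodule F (Fin n → F)}
    (hW : IsGenerator A W) (hU : IsTotallyIsotropic A U) :
    Module.finrank F U ≤ Module.finrank F W := by
  by_contra! h
  have hUB : ∀ x ∈ U, ∀ y ∈ U, Matrix.toBilin' A x y = 0 := fun x hx y hy => by
    rw [Matrix.toBilin'_apply']
    exact hU x hx y hy
  obtain ⟨u, huU, huW, hu⟩ :=
    LinearMap.BilinForm.exists_mem_notMem_orthogonal hUB h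
  have hext : IsTotallyIsotropic A (W ⊔ Submodule.span F {u}) := by
    intro x hx y hy
    obtain ⟨w, hw, v, hv, rfl⟩ := Submodule.mem_sup.mp hx
    obtain ⟨w', hw', v', hv', rfl⟩ := Submodule.mem_sup.mp hy
    obtain ⟨r, rfl⟩ := Submodule.mem_span_singleton.mp hv
    obtain ⟨r', rfl⟩ := Submodule.mem_span_singleton.mp hv'
    have hww := hW.prop w hw w' hw'
    rw [← Matrix.toBilin'_apply'] at hww ⊢
    simp [hww, hu w' hw', toBilin'_comm hA w u, hu w hw, hUB u huU u huU]
  exact huW (hW.le_of_ge hext le_sup_left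
    (Submodule.mem_sup_right (Submodule.mem_span_singleton_self u)))

/-- The generators are maximum cliques. -/
lemma IsGenerator.isNClique [Finite F] (h2 : (2 : F) ≠ 0)
    (hA : A.IsSymm) {W : Submodule F (Fin n → F)} (hW : IsGenerator A W)
    {K : Finset (Fin n → F)} (hK : (K : Set (Fin n → F)) = W) :
    (affinePolarGraph A).IsNClique (affinePolarGraph A).cliqueNum K := by
  have hcl : (affinePolarGraph A).IsClique (K : Set (Fin n → F)) := hK ▸ hW.prop.isClique
  refine ⟨hcl, le_antisymm (SimpleGraph.IsClique.card_le_cliqueNum (tc := hcl)) ?_⟩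
  obtain ⟨L, hL⟩ := (affinePolarGraph A).exists_isNClique_cliqueNum
  rw [← hL.card_eq]
  obtain rfl | ⟨l, hl⟩ := L.eq_empty_or_nonempty
  · simp
  -- The translate of the maximum clique by `-l` contains `0`.
  let M : Set (Fin n → F) := (fun x => x - l) '' L
  have hM : (affinePolarGraph A).IsClique M := by
    rintro _ ⟨x, hx, rfl⟩ _ ⟨y, hy, rfl⟩ hxy
    simpa [sub_eq_add_neg] using
      affinePolarGraph_adj_add x y (-l) (hL.isClique hx hy fun e => hxy (by simp [e]))
  have hspan := isTotallyIsotropic_span h2 hA hM ⟨l, hl, sub_self l⟩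
  calc L.card = M.ncard := by
        rw [Set.ncard_image_of_injective _ sub_left_injective, Set.ncard_coe_finset]
    _ ≤ Nat.card (Submodule.span F M) := 
        Set.ncard_le_ncard (Submodule.subset_span (R := F) (s := M)) (Set.toFinite _)
    _ ≤ Nat.card W := by
        rw [Module.natCard_eq_pow_finrank (K := F) (V := Submodule.span F M),
          Module.natCard_eq_pow_finrank (K := F) (V := W)]
        exact Nat.pow_le_pow_right (Nat.card_pos (α := F)) (hW.finrank_le hA hspan)
    _ = K.card := by rw [← Set.ncard_coe_finset, hK]; rfl

/-- For an independent set `S` that meets every translate of every generator exactly once, and a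
vertex `v` outside `S`, the lines joining `v` to its neighbours in `S` form an ovoid. -/
lemma exists_isOvoid [Finite F] (h2 : (2 : F) ≠ 0) (hA : A.IsSymm)
    (hw : ∃ w : Fin n → F, w ≠ 0 ∧ Matrix.toBilin' A w w = 0)
    (h : (affinePolarGraph A).cliqueNum * (affinePolarGraph A).indepNum =
      Nat.card (Fin n → F)) : ∃ O, IsOvoid A O := by
  classical
  have := Fintype.ofFinite F
  obtain ⟨S, hS⟩ := (affinePolarGraph A).exists_isNIndepSet_indepNum
  obtain ⟨w, hw0, hww⟩ := hw
  obtain ⟨v, hv⟩ : ∃ v, v ∉ S := by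
    by_contra! hall
    have hadj : (affinePolarGraph A).Adj w 0 :=
      affinePolarGraph_adj.mpr ⟨hw0, by rwa [sub_zero]⟩
    exact hS.isIndepSet (hall w) (hall 0) hw0 hadj
  refine ⟨{p | ∃ s ∈ S, (affinePolarGraph A).Adj s v ∧
    p.submodule = Submodule.span F {s - v}}, ?_, ?_⟩
  · rintro p ⟨s, -, hadj, hp⟩ x hx
    rw [hp] at hx
    obtain ⟨r, rfl⟩ := Submodule.mem_span_singleton.mp hx
    rw [← Matrix.toBilin'_apply']
    rw [LinearMap.map_smul₂, map_smul, (affinePolarGraph_adj.mp hadj).2, smul_zero, smul_zero]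
  · intro W hW
    obtain ⟨K, hK⟩ : ∃ K : Finset (Fin n → F), (K : Set (Fin n → F)) = W :=
      ⟨(W : Set (Fin n → F)).toFinset, by simp⟩
    have hmem : ∀ x, x ∈ K ↔ x ∈ W := fun x => by
      rw [← Finset.mem_coe, hK, SetLike.mem_coe]
    obtain ⟨⟨⟨k, hk⟩, ⟨s, hs⟩⟩, hks⟩ := (SimpleGraph.IsNClique.sub_bijective
      affinePolarGraph_adj_add h (hW.isNClique h2 hA hK) hS).surjective (-v)
    have hsv : s - v = k := by
      rw [sub_eq_add_neg, ← hks]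
      simp
    have hne : s ≠ v := fun e => hv (e ▸ hs)
    have hkW := (hmem k).mp hk
    refine ⟨Projectivization.mk F (s - v) (sub_ne_zero.mpr hne), ⟨⟨s, hs, ⟨hne, ?_⟩,
      Projectivization.submodule_mk _ _⟩, ?_⟩, ?_⟩
    · rw [hsv]
      exact hW.prop k hkW k hkW
    · rw [Projectivization.submodule_mk, hsv, Submodule.span_singleton_le_iff_mem]
      exact hkW
    · rintro p ⟨⟨t, ht, -, hp⟩, hpW⟩
      rw [hp, Submodule.span_singleton_le_iff_mem] at hpW
      have hts : t = s := by
        by_contra hts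
        refine hS.isIndepSet ht hs hts ⟨hts, ?_⟩
        have hd : t - s ∈ W := by
          have := W.sub_mem hpW (hsv ▸ hkW : s - v ∈ W)
          rwa [sub_sub_sub_cancel_right] at this
        exact hW.prop _ hd _ hd
      subst hts
      exact Projectivization.submodule_injective hp

end PolarSpace

theorem theorem4p14 {F : Type*} [Field F] [Finite F] (hF : ringChar F ≠ 2)
    {n : ℕ} (A : Matrix (Fin n) (Fin n) F) (hA : A.IsSymm) (hdet : A.det ≠ 0)
    (hr : 2 ≤ PolarSpace.wittIndex A)
    (htype : PolarSpace.IsParabolic A ∨ PolarSpace.IsHyperbolic A)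
    (Γ : SimpleGraph (Fin n → F)) (hΓ : Γ = PolarSpace.affinePolarGraph A) :
    [Γ.cliqueNum * Γ.indepNum = Nat.card (Fin n → F),
      Γ.CoreIsComplete,
      Γᶜ.CoreIsComplete,
      ¬ Γ.IsCore,
      Γ.chromaticNumber = (Γ.cliqueNum : ℕ∞)].TFAE ∧
    ((Γ.cliqueNum * Γ.indepNum = Nat.card (Fin n → F) ∨
      Γ.CoreIsComplete ∨
      Γᶜ.CoreIsComplete ∨
      ¬ Γ.IsCore ∨
      Γ.chromaticNumber = (Γ.cliqueNum : ℕ∞)) →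
        ∃ O : Set (ℙ F (Fin n → F)), PolarSpace.IsOvoid A O) := by
  have h2 : (2 : F) ≠ 0 := Ring.two_ne_zero hF
  have hw := PolarSpace.exists_isotropic_of_wittIndex_pos (A := A) (by omega)
  have hG : ∀ x y t, Γ.Adj x y → Γ.Adj (x + t) (y + t) := by
    rw [hΓ]
    exact PolarSpace.affinePolarGraph_adj_add
  have key := SimpleGraph.colorable_cliqueNum_iff_mul_eq hG
  have h12 : Γ.CoreIsComplete ↔ Γ.cliqueNum * Γ.indepNum = Nat.card (Fin n → F) :=
    SimpleGraph.coreIsComplete_iff_colorable.trans key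
  have h13 : Γᶜ.CoreIsComplete ↔ Γ.cliqueNum * Γ.indepNum = Nat.card (Fin n → F) := by
    rw [SimpleGraph.coreIsComplete_iff_colorable,
      SimpleGraph.colorable_cliqueNum_iff_mul_eq (SimpleGraph.compl_adj_add hG),
      SimpleGraph.cliqueNum_compl, SimpleGraph.indepNum_compl, mul_comm]
  have h15 : Γ.chromaticNumber = (Γ.cliqueNum : ℕ∞) ↔
      Γ.cliqueNum * Γ.indepNum = Nat.card (Fin n → F) :=
    SimpleGraph.chromaticNumber_eq_cliqueNum_iff.trans key
  have h14 : ¬ Γ.IsCore ↔ Γ.cliqueNum * Γ.indepNum = Nat.card (Fin n → F) := by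
    refine ⟨fun h => h12.mp ?_, fun h => (key.mpr h).not_isCore ?_⟩
    · subst hΓ
      exact PolarSpace.coreIsComplete_of_not_isCore h2 hA hdet hw h
    · rw [hΓ]
      exact PolarSpace.affinePolarGraph_ne_top h2 hA hdet (hw.imp fun _ h => h.1)
  rw [h12, h13, h14, h15]
  refine ⟨by simp +contextual [List.TFAE], fun h => ?_⟩
  rw [or_self, or_self, or_self, or_self, hΓ] at h
  exact PolarSpace.exists_isOvoid h2 hA hw h
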